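/- Weak König's Lemma ($\mathsf{WKL}$) admits preservation of the arithmetic hierarchy, that is: for every $Z \subseteq \omega$ and every $Z$-computable infinite binary tree $T \subseteq 2^{<\omega}$ there is an infinite path $G \subseteq \omega$ through $T$ (i.e. every finite initial segment of the characteristic function of $G$ belongs to $T$) such that for all $n > 0$ and all $A \subseteq \omega$: 1. if $A$ is properly $\Sigma^Z_n$, then $A$ is properly $\Sigma^{Z \oplus G}_n$; 2. if $A$ is properly $\Pi^Z_n$, then $A$ is properly $\Pi^{Z \oplus G}_n$; 3. if $A$ is properly $\Delta^Z_{n+1}$, then $A$ is properly $\Delta^{Z \oplus G}_{n+1}$. Here $Z \oplus G = \{2k : k \in Z\} \cup \{2k+1 : k \in G\}$; a binary tree is a set of finite binary strings closed under initial segments; $\Sigma^X_n$, $\Pi^X_n$ and $\Delta^X_n = \Sigma^X_n \cap \Pi^X_n$ denote the levels of the arithmetic hierarchy relative to $X$. A set is properly $\Sigma^X_n$ (properly $\Pi^X_n$) if it is $\Sigma^X_n$ ($\Pi^X_n$) but not $\Delta^X_n$, and properly $\Delta^X_{n+1}$ if it is $\Delta^X_{n+1}$ but neither $\Sigma^X_n$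 nor $\Pi^X_n$. -/

import Mathlib

namespace DefStrength

/-- The characteristic function of a set of natural numbers, as an oracle. -/
noncomputable def charFn (A : Set ℕ) : ℕ →. ℕ :=
  ((A.indicator 1 : ℕ → ℕ) : ℕ →. ℕ)

/-- Turing reducibility `A ≤_T X` between sets of natural numbers. -/
def ReducibleTo (A X : Set ℕ) : Prop :=
  TuringReducible (charFn A) (charFn X)

/-- The join `X ⊕ Y = {2n : n ∈ X} ∪ {2n + 1 : n ∈ Y}`. -/
def join (X Y : Set ℕ) : Set ℕ :=
  (fun n => 2 * n) '' X ∪ (fun n => 2 * n + 1) '' Y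

/-- `A` is `Σ^X_n`: `x ∈ A ↔ ∃ y₁ ∀ y₂ ∃ y₃ … R(x, y₁, …, y_n)` for some `X`-computable `R`.
At each step one quantifier is put in front of a `Π^X_n` relation, which is represented, via the
computable pairing function, as the set `B` below (so its complement is `Σ^X_n`). -/
def IsSigma (X : Set ℕ) : ℕ → Set ℕ → Prop
  | 0, A => ReducibleTo A X
  | n + 1, A => ∃ B : Set ℕ, IsSigma X n Bᶜ ∧ ∀ x, x ∈ A ↔ ∃ y, Nat.pair x y ∈ B

/-- `A` is `Π^X_n`: its complement is `Σ^X_n`. -/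
def IsPi (X : Set ℕ) (n : ℕ) (A : Set ℕ) : Prop :=
  IsSigma X n Aᶜ

/-- `A` is `Δ^X_n`: it is both `Σ^X_n` and `Π^X_n`. -/
def IsDelta (X : Set ℕ) (n : ℕ) (A : Set ℕ) : Prop :=
  IsSigma X n A ∧ IsPi X n A

/-- `A` is properly `Σ^X_n`. -/
def ProperlySigma (X : Set ℕ) (n : ℕ) (A : Set ℕ) : Prop :=
  IsSigma X n A ∧ ¬ IsDelta X n A

/-- `A` is properly `Π^X_n`. -/
def ProperlyPi (X : Set ℕ) (n : ℕ) (A : Set ℕ) : Prop :=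
  IsPi X n A ∧ ¬ IsDelta X n A

/-- `A` is properly `Δ^X_{n+1}`: it is `Δ^X_{n+1}`, but neither `Σ^X_n` nor `Π^X_n`. -/
def ProperlyDeltaSucc (X : Set ℕ) (n : ℕ) (A : Set ℕ) : Prop :=
  IsDelta X (n + 1) A ∧ ¬ IsSigma X n A ∧ ¬ IsPi X n A

/-- `Y` preserves the arithmetic hierarchy relative to `X`. -/
def PreservesArithHierarchy (Y X : Set ℕ) : Prop :=
  ∀ n : ℕ, 0 < n → ∀ A : Set ℕ,
    (ProperlySigma X n A → ProperlySigma (join X Y) n A) ∧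
    (ProperlyPi X n A → ProperlyPi (join X Y) n A) ∧
    (ProperlyDeltaSucc X n A → ProperlyDeltaSucc (join X Y) n A)

/-- The principle `∀ X ∃ Y φ(X, Y)` admits preservation of the arithmetic hierarchy. -/
def AdmitsPreservation (φ : Set ℕ → Set ℕ → Prop) : Prop :=
  ∀ Z X : Set ℕ, ReducibleTo X Z → ∃ Y : Set ℕ, PreservesArithHierarchy Y Z ∧ φ X Y

/-- The set of finite binary strings coded by a set of natural numbers
(`Encodable.encode` is a computable injection of `List Bool` into `ℕ`). -/
def codedStrings (X : Set ℕ) : Set (List Bool) :=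
  {σ | Encodable.encode σ ∈ X}

/-- A binary tree: a set of finite binary strings closed under initial segments. -/
def IsBinaryTree (T : Set (List Bool)) : Prop :=
  ∀ σ τ : List Bool, σ <+: τ → τ ∈ T → σ ∈ T

open Classical in
/-- The initial segment of length `n` of the characteristic function of `Y`. -/
noncomputable def initSeg (Y : Set ℕ) (n : ℕ) : List Bool :=
  (List.range n).map fun i => decide (i ∈ Y)

/-- `Y` is an infinite path through `T`. -/
def IsPath (T : Set (List Bool)) (Y : Set ℕ) : Prop :=
  ∀ n, initSeg Y n ∈ T

/-- The matrix `φ(X, Y)` of Weak König's Lemma `∀ X ∃ Y φ(X, Y)`: if `X` codes an infinite binary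
tree, then `Y` is an infinite path through it. -/
def WKL (X Y : Set ℕ) : Prop :=
  IsBinaryTree (codedStrings X) → (codedStrings X).Infinite → IsPath (codedStrings X) Y

end DefStrength

/-! The path is built by forcing with nonempty classes that are effectively closed relative to `Z`;
a condition is a finite list of indices of open sets to be avoided. The paths through a
`Z`-computable tree form such a class (`exists_closedSet_eq_paths`), which serves as the initial
condition.

Every `Σ_{n+1}` set relative to `join Z G` is the truth set of a universal formula (`exists_sat`).
Each such formula has a forcing question which, for a fixed condition, is itself `Σ_{n+1}` relative
to `Z` (`isSigma_question`). At the bottom it asks whether no member of the class falsifies the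
formula, a `Σ_1` matter by compactness; each further level asks for a witness and a nonempty
extension with a negative answer one level below. After a positive answer some extension forces the
formula; after a negative one some extension forces its negation. Hence if `A` is not `Σ_{n+1}`
relative to `Z`, the question's answers differ from `A` at some `x`, and an extension forces the
formula to disagree with `A` there (`exists_forces_ne`).

A generic `G` (`exists_generic`) meets all these requirements for the countably many
`Z`-arithmetical sets, and what is forced is true of it (`sat_of_forces`, `not_sat_of_forcesNot`).
So no such set becomes `Σ_{n+1}` unless it already was. Applied to sets and their complements, this
yields all three clauses. -/

namespace DefStrength

open Encodable Nat.Partrec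

/-! ### Bounded quantification of primitive recursive predicates -/

section PrimrecPred

variable {α : Type*} [Primcodable α]

theorem primrecPred_exists_mem {β : Type*} [Primcodable β] {p : α → β → Prop} {b : α → List β}
    (hb : Primrec b) (hp : PrimrecPred fun q : α × β => p q.1 q.2) :
    PrimrecPred fun a => ∃ x ∈ b a, p a x :=
  (PrimrecRel.exists_mem_list (R := fun x a => p a x)
    (PrimrecPred.comp (f := Prod.swap) hp (Primrec.pair Primrec.snd Primrec.fst))).comp hb Primrec.id

theorem primrecPred_forall_mem {β : Type*} [Primcodable β] {p : α → β → Prop} {b : α → List β}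
    (hb : Primrec b) (hp : PrimrecPred fun q : α × β => p q.1 q.2) :
    PrimrecPred fun a => ∀ x ∈ b a, p a x :=
  (PrimrecRel.forall_mem_list (R := fun x a => p a x)
    (PrimrecPred.comp (f := Prod.swap) hp (Primrec.pair Primrec.snd Primrec.fst))).comp hb Primrec.id

theorem primrecPred_exists_lt {p : α → ℕ → Prop} {b : α → ℕ} (hb : Primrec b)
    (hp : PrimrecPred fun q : α × ℕ => p q.1 q.2) : PrimrecPred fun a => ∃ x < b a, p a x :=
  (primrecPred_exists_mem (Primrec.list_range.comp hb) hp).of_eq (by simp)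

theorem primrecPred_forall_lt {p : α → ℕ → Prop} {b : α → ℕ} (hb : Primrec b)
    (hp : PrimrecPred fun q : α × ℕ => p q.1 q.2) : PrimrecPred fun a => ∀ x < b a, p a x :=
  (primrecPred_forall_mem (Primrec.list_range.comp hb) hp).of_eq (by simp)

theorem primrecPred_eq {β : Type*} [Primcodable β] [DecidableEq β] {f g : α → β} (hf : Primrec f)
    (hg : Primrec g) : PrimrecPred fun a => f a = g a :=
  PrimrecRel.comp Primrec.eq hf hg

end PrimrecPred

/-! ### Initial segments and the use principle -/

theorem length_initSeg (X : Set ℕ) (n : ℕ) : (initSeg X n).length = n := by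
  simp [initSeg]

open Classical in
theorem getElem?_initSeg (X : Set ℕ) (n i : ℕ) :
    (initSeg X n)[i]? = if i < n then some (decide (i ∈ X)) else none := by
  by_cases h : i < n <;> simp [initSeg, h]

theorem take_initSeg (X : Set ℕ) {m n : ℕ} (h : m ≤ n) :
    (initSeg X n).take m = initSeg X m := by
  simp [initSeg, ← List.map_take, List.take_range, h]

theorem initSeg_prefix (X : Set ℕ) {m n : ℕ} (h : m ≤ n) : initSeg X m <+: initSeg X n := by
  rw [← take_initSeg X h]; exact List.take_prefix _ _

/-- The graph of `f` is enumerated by a primitive recursive relation which consults only initial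
segments of `X`. -/
def GraphEnum (X : Set ℕ) (f : ℕ → Part ℕ) : Prop :=
  ∃ R : ℕ → ℕ → List Bool → Prop, (PrimrecPred fun q : (ℕ × ℕ) × List Bool => R q.1.1 q.1.2 q.2) ∧
    (∀ x y σ τ, σ <+: τ → R x y σ → R x y τ) ∧ ∀ x y, y ∈ f x ↔ ∃ k, R x y (initSeg X k)

theorem exists_uniform_bound {P : ℕ → ℕ → Prop} (hP : ∀ i k k', k ≤ k' → P i k → P i k') (n : ℕ)
    (h : ∀ i < n, ∃ k, P i k) : ∃ K, ∀ i < n, P i K := by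
  choose! g hg using h
  refine ⟨(Finset.range n).sup g, fun i hi => hP _ _ _ ?_ (hg i hi)⟩
  exact Finset.le_sup (f := g) (Finset.mem_range.2 hi)

theorem graphEnum_of_primrec (X : Set ℕ) {f : ℕ → ℕ} (hf : Primrec f) : GraphEnum X fun n => Part.some (f n) := by
  refine ⟨fun x y _ => y = f x, primrecPred_eq (Primrec.snd.comp Primrec.fst)
    (hf.comp (Primrec.fst.comp Primrec.fst)), fun _ _ _ _ _ h => h, fun x y => ?_⟩
  simp

theorem GraphEnum.charFn (X : Set ℕ) : GraphEnum X (charFn X) := by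
  refine ⟨fun x y σ => σ[x]? = some true ∧ y = 1 ∨ σ[x]? = some false ∧ y = 0, ?_, ?_, ?_⟩
  · have hx : Primrec fun q : (ℕ × ℕ) × List Bool => q.2[q.1.1]? :=
      Primrec.list_getElem?.comp Primrec.snd (Primrec.fst.comp Primrec.fst)
    have hy : Primrec fun q : (ℕ × ℕ) × List Bool => q.1.2 := Primrec.snd.comp Primrec.fst
    exact ((primrecPred_eq hx (Primrec.const _)).and (primrecPred_eq hy (Primrec.const _))).or
      ((primrecPred_eq hx (Primrec.const _)).and (primrecPred_eq hy (Primrec.const _)))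
  · rintro x y σ _ ⟨ρ, rfl⟩ h
    have : ∀ b, σ[x]? = some b → (σ ++ ρ)[x]? = some b := fun b hb => by
      have hlt : x < σ.length := by
        by_contra hn; simp [List.getElem?_eq_none (not_lt.1 hn)] at hb
      rw [List.getElem?_append_left hlt, hb]
    exact h.imp (fun h => ⟨this _ h.1, h.2⟩) (fun h => ⟨this _ h.1, h.2⟩)
  · intro x y
    by_cases hx : x ∈ X
    · simp only [DefStrength.charFn, PFun.coe_val, Part.mem_some_iff, Set.indicator_of_mem hx,
        getElem?_initSeg, hx]
      exact ⟨fun h => ⟨x + 1, by simp [h]⟩, fun ⟨k, h⟩ => by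
        by_cases hk : x < k <;> simp_all⟩
    · simp only [DefStrength.charFn, PFun.coe_val, Part.mem_some_iff, Set.indicator_of_notMem hx,
        getElem?_initSeg, hx]
      exact ⟨fun h => ⟨x + 1, by simp [h]⟩, fun ⟨k, h⟩ => by
        by_cases hk : x < k <;> simp_all⟩

theorem GraphEnum.pair {X : Set ℕ} {f g : ℕ → Part ℕ} (hf : GraphEnum X f) (hg : GraphEnum X g) :
    GraphEnum X fun n => Nat.pair <$> f n <*> g n := by
  obtain ⟨R, hR, mR, eR⟩ := hf
  obtain ⟨S, hS, mS, eS⟩ := hg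
  refine ⟨fun x y σ => R x y.unpair.1 σ ∧ S x y.unpair.2 σ, ?_, ?_, ?_⟩
  · have hu : Primrec fun q : (ℕ × ℕ) × List Bool => q.1.2.unpair :=
      Primrec.unpair.comp (Primrec.snd.comp Primrec.fst)
    have hx : Primrec fun q : (ℕ × ℕ) × List Bool => q.1.1 := Primrec.fst.comp Primrec.fst
    exact (hR.comp (((hx.pair (Primrec.fst.comp hu))).pair Primrec.snd)).and
      (hS.comp (((hx.pair (Primrec.snd.comp hu))).pair Primrec.snd))
  · exact fun x y σ τ h h' => ⟨mR _ _ _ _ h h'.1, mS _ _ _ _ h h'.2⟩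
  · intro x y
    have : y ∈ (Nat.pair <$> f x <*> g x : Part ℕ) ↔ y.unpair.1 ∈ f x ∧ y.unpair.2 ∈ g x := by
      simp only [Seq.seq, Part.map_eq_map, Part.mem_bind_iff, Part.mem_map_iff]
      constructor
      · rintro ⟨_, ⟨a, ha, rfl⟩, b, hb, rfl⟩; simpa using ⟨ha, hb⟩
      · rintro ⟨ha, hb⟩; exact ⟨_, ⟨_, ha, rfl⟩, _, hb, by simp⟩
    rw [this, eR, eS]
    constructor
    · rintro ⟨⟨k, hk⟩, l, hl⟩
      exact ⟨max k l, mR _ _ _ _ (initSeg_prefix X (le_max_left _ _)) hk,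
        mS _ _ _ _ (initSeg_prefix X (le_max_right _ _)) hl⟩
    · rintro ⟨k, h₁, h₂⟩; exact ⟨⟨k, h₁⟩, k, h₂⟩

theorem GraphEnum.comp {X : Set ℕ} {f g : ℕ → Part ℕ} (hf : GraphEnum X f) (hg : GraphEnum X g) :
    GraphEnum X fun n => g n >>= f := by
  obtain ⟨R, hR, mR, eR⟩ := hf
  obtain ⟨S, hS, mS, eS⟩ := hg
  -- The length of `σ` doubles as a search bound: it keeps the relation primitive recursive, and
  -- longer initial segments reach every `z`.
  refine ⟨fun x y σ => ∃ z < σ.length, S x z σ ∧ R z y σ, ?_, ?_, ?_⟩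
  · refine primrecPred_exists_lt (Primrec.list_length.comp Primrec.snd) ?_
    have hx : Primrec fun q : ((ℕ × ℕ) × List Bool) × ℕ => q.1.1.1 :=
      Primrec.fst.comp (Primrec.fst.comp Primrec.fst)
    have hy : Primrec fun q : ((ℕ × ℕ) × List Bool) × ℕ => q.1.1.2 :=
      Primrec.snd.comp (Primrec.fst.comp Primrec.fst)
    have hs : Primrec fun q : ((ℕ × ℕ) × List Bool) × ℕ => q.1.2 := Primrec.snd.comp Primrec.fst
    exact (hS.comp ((hx.pair Primrec.snd).pair hs)).and (hR.comp ((Primrec.snd.pair hy).pair hs))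
  · rintro x y σ τ h ⟨z, hz, h₁, h₂⟩
    exact ⟨z, hz.trans_le h.length_le, mS _ _ _ _ h h₁, mR _ _ _ _ h h₂⟩
  · intro x y
    simp only [Part.bind_eq_bind, Part.mem_bind_iff, eR, eS, length_initSeg]
    constructor
    · rintro ⟨z, ⟨k, hk⟩, l, hl⟩
      refine ⟨max (z + 1) (max k l), z, by omega, mS _ _ _ _ (initSeg_prefix X (by omega)) hk,
        mR _ _ _ _ (initSeg_prefix X (by omega)) hl⟩
    · rintro ⟨k, z, -, h₁, h₂⟩; exact ⟨z, ⟨k, h₁⟩, k, h₂⟩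

/-- The list `L` records all intermediate values, so that a whole recursion has a single numerical
witness, its code. -/
theorem mem_rec_iff {f h : ℕ → Part ℕ} {a n y : ℕ} :
    y ∈ (Nat.rec (f a) (fun y IH =>
      Part.bind IH fun i => h (Nat.pair a (Nat.pair y i))) n : Part ℕ) ↔
      ∃ L : List ℕ, L.getD 0 0 ∈ f a ∧ L.length = n + 1 ∧
        (∀ i < n, L.getD (i + 1) 0 ∈ h (Nat.pair a (Nat.pair i (L.getD i 0)))) ∧
          L.getD n 0 = y := by
  induction n generalizing y with
  | zero =>
    constructor
    · intro hy; exact ⟨[y], by simpa using hy, rfl, by simp, rfl⟩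
    · rintro ⟨L, h₀, -, -, rfl⟩; exact h₀
  | succ n ih =>
    refine Part.mem_bind_iff.trans ?_
    simp only [ih]
    constructor
    · rintro ⟨z, ⟨L, h₀, hl, hs, rfl⟩, hy⟩
      have key : ∀ i ≤ n, (L ++ [y]).getD i 0 = L.getD i 0 := fun i hi =>
        List.getD_append _ _ _ _ (by omega)
      have last : (L ++ [y]).getD (n + 1) 0 = y := by
        rw [List.getD_append_right _ _ _ _ hl.le]; simp [hl]
      refine ⟨L ++ [y], by rwa [key _ (Nat.zero_le _)], by simp [hl], fun i hi => ?_, last⟩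
      rcases (Nat.lt_succ_iff.1 hi).lt_or_eq with hi | rfl
      · rw [key _ hi, key _ hi.le]; exact hs i hi
      · rw [last, key _ le_rfl]; exact hy
    · rintro ⟨L, h₀, hl, hs, rfl⟩
      refine ⟨L.getD n 0, ⟨L.take (n + 1), ?_, by simp [hl], fun i hi => ?_, ?_⟩, hs n (by omega)⟩
      · simpa [List.getD_eq_getElem?_getD] using h₀
      · simpa [List.getD_eq_getElem?_getD, List.getElem?_take, show i < n + 1 by omega, hi] using
          hs i (by omega)
      · simp [List.getD_eq_getElem?_getD]

theorem GraphEnum.prec {X : Set ℕ} {f g : ℕ → Part ℕ} (hf : GraphEnum X f) (hg : GraphEnum X g) :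
    GraphEnum X fun p =>
      (Nat.rec (f p.unpair.1) (fun y IH =>
        Part.bind IH fun i => g (Nat.pair p.unpair.1 (Nat.pair y i))) p.unpair.2 : Part ℕ) := by
  obtain ⟨R, hR, mR, eR⟩ := hf
  obtain ⟨S, hS, mS, eS⟩ := hg
  refine ⟨fun x y σ => ∃ s < σ.length, R x.unpair.1 ((Denumerable.ofNat (List ℕ) s).getD 0 0) σ ∧
    (Denumerable.ofNat (List ℕ) s).length = x.unpair.2 + 1 ∧
    (∀ i < x.unpair.2, S (Nat.pair x.unpair.1
      (Nat.pair i ((Denumerable.ofNat (List ℕ) s).getD i 0)))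
        ((Denumerable.ofNat (List ℕ) s).getD (i + 1) 0) σ) ∧
    (Denumerable.ofNat (List ℕ) s).getD x.unpair.2 0 = y, ?_, ?_, ?_⟩
  · refine primrecPred_exists_lt (Primrec.list_length.comp Primrec.snd) ?_
    have hx : Primrec fun q : ((ℕ × ℕ) × List Bool) × ℕ => q.1.1.1.unpair :=
      Primrec.unpair.comp (Primrec.fst.comp (Primrec.fst.comp Primrec.fst))
    have hy : Primrec fun q : ((ℕ × ℕ) × List Bool) × ℕ => q.1.1.2 :=
      Primrec.snd.comp (Primrec.fst.comp Primrec.fst)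
    have hs : Primrec fun q : ((ℕ × ℕ) × List Bool) × ℕ => q.1.2 := Primrec.snd.comp Primrec.fst
    have hL : Primrec fun q : ((ℕ × ℕ) × List Bool) × ℕ => Denumerable.ofNat (List ℕ) q.2 :=
      (Primrec.ofNat (List ℕ)).comp Primrec.snd
    have hget : Primrec₂ fun (l : List ℕ) n => l.getD n 0 := Primrec.list_getD 0
    refine (hR.comp (((Primrec.fst.comp hx).pair (hget.comp hL (Primrec.const 0))).pair hs)).and
      ((primrecPred_eq (Primrec.list_length.comp hL) (Primrec.succ.comp (Primrec.snd.comp hx))).and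
      (PrimrecPred.and ?_ (primrecPred_eq (hget.comp hL (Primrec.snd.comp hx)) hy)))
    refine primrecPred_forall_lt (Primrec.snd.comp hx) ?_
    have hL' := hL.comp (Primrec.fst (α := ((ℕ × ℕ) × List Bool) × ℕ) (β := ℕ))
    refine hS.comp (((Primrec₂.natPair.comp (Primrec.fst.comp (hx.comp Primrec.fst))
      (Primrec₂.natPair.comp Primrec.snd (hget.comp hL' Primrec.snd))).pair
      (hget.comp hL' (Primrec.succ.comp Primrec.snd))).pair (hs.comp Primrec.fst))
  · rintro x y σ τ h ⟨s, hs, h₁, h₂, h₃, h₄⟩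
    exact ⟨s, hs.trans_le h.length_le, mR _ _ _ _ h h₁, h₂, fun i hi => mS _ _ _ _ h (h₃ i hi), h₄⟩
  · intro x y
    refine (mem_rec_iff (f := f) (h := g)).trans ?_
    simp only [eR, eS, length_initSeg]
    constructor
    · rintro ⟨L, ⟨k, h₀⟩, hl, hs, hy⟩
      obtain ⟨K, hK⟩ := exists_uniform_bound
        (P := fun i k => S (Nat.pair x.unpair.1 (Nat.pair i (L.getD i 0))) (L.getD (i + 1) 0)
          (initSeg X k)) (fun i k k' h => mS _ _ _ _ (initSeg_prefix X h)) _ hs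
      refine ⟨max (encode L + 1) (max k K), encode L, by omega, ?_⟩
      rw [Denumerable.ofNat_encode]
      exact ⟨mR _ _ _ _ (initSeg_prefix X (by omega)) h₀, hl,
        fun i hi => mS _ _ _ _ (initSeg_prefix X (by omega)) (hK i hi), hy⟩
    · rintro ⟨k, s, -, h₀, hl, hs, hy⟩
      exact ⟨_, ⟨k, h₀⟩, hl, fun i hi => ⟨k, hs i hi⟩, hy⟩

theorem GraphEnum.rfind {X : Set ℕ} {f : ℕ → Part ℕ} (hf : GraphEnum X f) :
    GraphEnum X fun a => Nat.rfind fun n => (fun m => decide (m = 0)) <$> f (Nat.pair a n) := by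
  obtain ⟨R, hR, mR, eR⟩ := hf
  refine ⟨fun x y σ => R (Nat.pair x y) 0 σ ∧
    ∀ m < y, ∃ v < σ.length, v ≠ 0 ∧ R (Nat.pair x m) v σ, ?_, ?_, ?_⟩
  · have hx : Primrec fun q : (ℕ × ℕ) × List Bool => q.1.1 := Primrec.fst.comp Primrec.fst
    have hy : Primrec fun q : (ℕ × ℕ) × List Bool => q.1.2 := Primrec.snd.comp Primrec.fst
    refine (hR.comp (((Primrec₂.natPair.comp hx hy).pair (Primrec.const 0)).pair Primrec.snd)).and
      (primrecPred_forall_lt hy (primrecPred_exists_lt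
        (Primrec.list_length.comp (Primrec.snd.comp Primrec.fst)) ?_))
    have hq := Primrec.fst.comp (Primrec.fst (α := ((ℕ × ℕ) × List Bool) × ℕ) (β := ℕ))
    exact (primrecPred_eq Primrec.snd (Primrec.const 0)).not.and
      (hR.comp (((Primrec₂.natPair.comp (hx.comp hq) (Primrec.snd.comp Primrec.fst)).pair
        Primrec.snd).pair (Primrec.snd.comp hq)))
  · rintro x y σ τ h ⟨h₁, h₂⟩
    refine ⟨mR _ _ _ _ h h₁, fun m hm => ?_⟩
    obtain ⟨v, hv, hv0, hr⟩ := h₂ m hm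
    exact ⟨v, hv.trans_le h.length_le, hv0, mR _ _ _ _ h hr⟩
  · intro x y
    have h1 : ∀ n b, b ∈ ((fun m => decide (m = 0)) <$> f (Nat.pair x n) : Part Bool) ↔
        ∃ v ∈ f (Nat.pair x n), decide (v = 0) = b := fun n b => by
      simp [Part.map_eq_map]
    have h2 : y ∈ Nat.rfind (fun n => (fun m => decide (m = 0)) <$> f (Nat.pair x n)) ↔
        (∃ v ∈ f (Nat.pair x y), decide (v = 0) = true) ∧
          ∀ m < y, ∃ v ∈ f (Nat.pair x m), decide (v = 0) = false :=
      Nat.mem_rfind.trans (and_congr (h1 _ _) (forall₂_congr fun m _ => h1 m _))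
    refine h2.trans ?_
    simp only [eR, length_initSeg, decide_eq_true_eq, decide_eq_false_iff_not]
    constructor
    · rintro ⟨⟨_, ⟨k, hk⟩, rfl⟩, h⟩
      obtain ⟨K, hK⟩ := exists_uniform_bound (n := y)
        (P := fun m k => ∃ v < k, v ≠ 0 ∧ R (Nat.pair x m) v (initSeg X k))
        (fun i k k' h ⟨v, h₁, h₂, h₃⟩ => ⟨v, by omega, h₂, mR _ _ _ _ (initSeg_prefix X h) h₃⟩)
        (fun m hm => by
          obtain ⟨v, ⟨k, hk⟩, hv⟩ := h m hm
          exact ⟨max k (v + 1), v, by omega, hv, mR _ _ _ _ (initSeg_prefix X (by omega)) hk⟩)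
      refine ⟨max k K, mR _ _ _ _ (initSeg_prefix X (by omega)) hk, fun m hm => ?_⟩
      obtain ⟨v, h₁, h₂, h₃⟩ := hK m hm
      exact ⟨v, by omega, h₂, mR _ _ _ _ (initSeg_prefix X (by omega)) h₃⟩
    · rintro ⟨k, h₁, h₂⟩
      refine ⟨⟨0, ⟨k, h₁⟩, rfl⟩, fun m hm => ?_⟩
      obtain ⟨v, -, hv0, hr⟩ := h₂ m hm
      exact ⟨v, ⟨k, hr⟩, hv0⟩

/-- A halting oracle computation consults only finitely many bits; this is the use principle, by
induction on the computation. -/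
theorem graphEnum_of_recursiveIn {X : Set ℕ} {f : ℕ →. ℕ}
    (hf : Nat.RecursiveIn {charFn X} f) : GraphEnum X f := by
  induction hf with
  | zero => exact graphEnum_of_primrec X (Primrec.const 0)
  | succ => exact graphEnum_of_primrec X Primrec.succ
  | left => exact graphEnum_of_primrec X (Primrec.fst.comp Primrec.unpair)
  | right => exact graphEnum_of_primrec X (Primrec.snd.comp Primrec.unpair)
  | oracle g hg => rw [Set.mem_singleton_iff.1 hg]; exact GraphEnum.charFn X
  | pair _ _ ih₁ ih₂ => exact ih₁.pair ih₂
  | comp _ _ ih₁ ih₂ => exact ih₁.comp ih₂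
  | prec _ _ ih₁ ih₂ => exact ih₁.prec ih₂
  | rfind _ ih => exact ih.rfind

/-! ### Total functions and sets computable from `Z` -/

/-- The total function `f` is computable from `Z`. -/
def TotalIn (Z : Set ℕ) (f : ℕ → ℕ) : Prop :=
  Nat.RecursiveIn {charFn Z} fun n => Part.some (f n)

theorem reducibleTo_iff {A Z : Set ℕ} : ReducibleTo A Z ↔ TotalIn Z (A.indicator 1) :=
  RecursiveIn.iff_nat

theorem TotalIn.of_eq {Z : Set ℕ} {f g : ℕ → ℕ} (hf : TotalIn Z f) (h : ∀ n, f n = g n) :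
    TotalIn Z g :=
  funext h ▸ hf

theorem TotalIn.of_primrec {Z : Set ℕ} {f : ℕ → ℕ} (hf : Primrec f) : TotalIn Z f :=
  Nat.Primrec.recursiveIn (Primrec.nat_iff.1 hf)

theorem TotalIn.comp {Z : Set ℕ} {f g : ℕ → ℕ} (hf : TotalIn Z f) (hg : TotalIn Z g) :
    TotalIn Z fun n => f (g n) :=
  (Nat.RecursiveIn.comp hf hg).of_eq fun _ => Part.bind_some _ _

theorem TotalIn.pair {Z : Set ℕ} {f g : ℕ → ℕ} (hf : TotalIn Z f) (hg : TotalIn Z g) :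
    TotalIn Z fun n => Nat.pair (f n) (g n) :=
  (Nat.RecursiveIn.pair hf hg).of_eq fun _ => by simp [Seq.seq]

theorem TotalIn.nat_rec {Z : Set ℕ} {g : ℕ → ℕ} (a : ℕ) (hg : TotalIn Z g) :
    TotalIn Z fun n => Nat.rec a (fun m v => g (Nat.pair m v)) n := by
  have h₁ : TotalIn Z fun p => g p.unpair.2 :=
    hg.comp (.of_primrec (Primrec.snd.comp Primrec.unpair))
  have h₂ : TotalIn Z fun p =>
      Nat.rec a (fun m v => g (Nat.pair m v)) p.unpair.2 := by
    refine (Nat.RecursiveIn.prec (TotalIn.of_primrec (Primrec.const a)) h₁).of_eq fun p => ?_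
    dsimp only
    induction p.unpair.2 with
    | zero => rfl
    | succ n ih => simp only [ih]; simp
  exact (h₂.comp (.of_primrec (Primrec₂.natPair.comp (Primrec.const 0) Primrec.id))).of_eq
    fun n => by simp

theorem TotalIn.indicator (Z : Set ℕ) : TotalIn Z (Z.indicator 1) :=
  Nat.RecursiveIn.oracle _ rfl

theorem TotalIn.encode_initSeg (Z : Set ℕ) : TotalIn Z fun n => encode (initSeg Z n) := by
  have hp : Primrec fun q : ℕ => encode
      (((decode (α := List Bool) q.unpair.2.unpair.2).getD []) ++ [decide (q.unpair.1 = 1)]) := by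
    have hu : Primrec fun q : ℕ => q.unpair := Primrec.unpair
    refine Primrec.encode.comp (Primrec.list_append.comp (Primrec.option_getD.comp
      (Primrec.decode.comp (Primrec.snd.comp (Primrec.unpair.comp (Primrec.snd.comp hu))))
      (Primrec.const _)) (Primrec.list_cons.comp ?_ (Primrec.const _)))
    exact PrimrecPred.decide (primrecPred_eq (Primrec.fst.comp hu) (Primrec.const 1))
  have hg : TotalIn Z fun p => Nat.pair (Z.indicator 1 p.unpair.1) p :=
    ((TotalIn.indicator Z).comp (.of_primrec (Primrec.fst.comp Primrec.unpair))).pair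
      (.of_primrec Primrec.id)
  refine (TotalIn.nat_rec (encode ([] : List Bool)) ((TotalIn.of_primrec hp).comp hg)).of_eq
    fun n => ?_
  induction n with
  | zero => rfl
  | succ n ih =>
    simp only [ih]
    by_cases h : n ∈ Z <;> simp [initSeg, List.range_succ, h]

open Classical in
theorem TotalIn.indicator_of_primrecPred (Z : Set ℕ) {P : ℕ → List Bool → Prop} {b : ℕ → ℕ}
    (hP : PrimrecPred fun q : ℕ × List Bool => P q.1 q.2) (hb : Primrec b) :
    TotalIn Z ({w | P w (initSeg Z (b w))}.indicator 1) := by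
  have hp : Primrec fun q : ℕ =>
      if P q.unpair.1 ((decode (α := List Bool) q.unpair.2).getD []) then 1 else 0 := by
    refine Primrec.ite (PrimrecPred.comp hP ((Primrec.fst.comp Primrec.unpair).pair
      (Primrec.option_getD.comp (Primrec.decode.comp (Primrec.snd.comp Primrec.unpair))
        (Primrec.const _)))) (Primrec.const 1) (Primrec.const 0)
  refine ((TotalIn.of_primrec hp).comp ((TotalIn.of_primrec Primrec.id).pair
    ((TotalIn.encode_initSeg Z).comp (.of_primrec hb)))).of_eq fun n => ?_
  simp [Set.indicator_apply]

theorem reducibleTo_of_primrecPred (Z : Set ℕ) {P : ℕ → List Bool → Prop} {b : ℕ → ℕ}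
    (hP : PrimrecPred fun q : ℕ × List Bool => P q.1 q.2) (hb : Primrec b) :
    ReducibleTo {w | P w (initSeg Z (b w))} Z :=
  reducibleTo_iff.2 (TotalIn.indicator_of_primrecPred Z hP hb)

theorem ReducibleTo.preimage {A Z : Set ℕ} (hA : ReducibleTo A Z) {f : ℕ → ℕ} (hf : Primrec f) :
    ReducibleTo (f ⁻¹' A) Z :=
  reducibleTo_iff.2 ((reducibleTo_iff.1 hA).comp (.of_primrec hf))

theorem ReducibleTo.compl {A Z : Set ℕ} (hA : ReducibleTo A Z) : ReducibleTo Aᶜ Z := by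
  refine reducibleTo_iff.2 ((TotalIn.comp (TotalIn.of_primrec
    (Primrec.nat_sub.comp (Primrec.const 1) Primrec.id)) (reducibleTo_iff.1 hA)).of_eq fun n => ?_)
  by_cases h : n ∈ A <;> simp [h]

theorem ReducibleTo.inter {A B Z : Set ℕ} (hA : ReducibleTo A Z) (hB : ReducibleTo B Z) :
    ReducibleTo (A ∩ B) Z := by
  refine reducibleTo_iff.2 ((TotalIn.comp (TotalIn.of_primrec
    (Primrec.nat_mul.comp (Primrec.fst.comp Primrec.unpair) (Primrec.snd.comp Primrec.unpair)))
    ((reducibleTo_iff.1 hA).pair (reducibleTo_iff.1 hB))).of_eq fun n => ?_)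
  by_cases h : n ∈ A <;> by_cases h' : n ∈ B <;> simp [h, h']

theorem ReducibleTo.union {A B Z : Set ℕ} (hA : ReducibleTo A Z) (hB : ReducibleTo B Z) :
    ReducibleTo (A ∪ B) Z := by
  simpa [Set.compl_inter] using (hA.compl.inter hB.compl).compl

/-! ### Closure properties of the arithmetic hierarchy -/

theorem isSigma_exists_notMem {Z C : Set ℕ} {n : ℕ} (hC : IsSigma Z n C) :
    IsSigma Z (n + 1) {x | ∃ y, Nat.pair x y ∉ C} :=
  ⟨Cᶜ, by rwa [compl_compl], fun _ => Iff.rfl⟩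

theorem isSigma_succ_iff {Z A : Set ℕ} {n : ℕ} :
    IsSigma Z (n + 1) A ↔ ∃ C, IsSigma Z n C ∧ A = {x | ∃ y, Nat.pair x y ∉ C} := by
  constructor
  · rintro ⟨B, hB, h⟩
    exact ⟨Bᶜ, hB, by ext x; simpa using h x⟩
  · rintro ⟨C, hC, rfl⟩
    exact isSigma_exists_notMem hC

theorem IsSigma.preimage {Z A : Set ℕ} {n : ℕ} (hA : IsSigma Z n A) {f : ℕ → ℕ} (hf : Primrec f) :
    IsSigma Z n (f ⁻¹' A) := by
  induction n generalizing A f with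
  | zero => exact ReducibleTo.preimage hA hf
  | succ n ih =>
    obtain ⟨C, hC, rfl⟩ := isSigma_succ_iff.1 hA
    refine isSigma_succ_iff.2 ⟨_, ih hC (f := fun w => Nat.pair (f w.unpair.1) w.unpair.2)
      (Primrec₂.natPair.comp (hf.comp (Primrec.fst.comp Primrec.unpair))
        (Primrec.snd.comp Primrec.unpair)), ?_⟩
    ext x; simp

/-- Negation under the quantifier swaps the operations: intersections at level `n + 1` need unions
at level `n` and conversely, so both go through one induction. -/
theorem IsSigma.inter_union {Z A B : Set ℕ} {n : ℕ} (hA : IsSigma Z n A) (hB : IsSigma Z n B) :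
    IsSigma Z n (A ∩ B) ∧ IsSigma Z n (A ∪ B) := by
  induction n generalizing A B with
  | zero => exact ⟨ReducibleTo.inter hA hB, ReducibleTo.union hA hB⟩
  | succ n ih =>
    obtain ⟨C, hC, rfl⟩ := isSigma_succ_iff.1 hA
    obtain ⟨D, hD, rfl⟩ := isSigma_succ_iff.1 hB
    refine ⟨?_, isSigma_succ_iff.2 ⟨C ∩ D, (ih hC hD).1, ?_⟩⟩
    · have hp : ∀ g : ℕ × ℕ → ℕ, Primrec g →
          Primrec fun w : ℕ => Nat.pair w.unpair.1 (g w.unpair.2.unpair) := fun g hg =>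
        Primrec₂.natPair.comp (Primrec.fst.comp Primrec.unpair)
          (hg.comp (Primrec.unpair.comp (Primrec.snd.comp Primrec.unpair)))
      refine isSigma_succ_iff.2 ⟨_, (ih (hC.preimage (hp _ Primrec.fst))
        (hD.preimage (hp _ Primrec.snd))).2, ?_⟩
      ext x
      simp only [Set.mem_inter_iff, Set.mem_ofPred_eq, Set.mem_union, Set.mem_preimage, not_or,
        Nat.unpair_pair]
      constructor
      · rintro ⟨⟨y, hy⟩, z, hz⟩; exact ⟨Nat.pair y z, by simpa using ⟨hy, hz⟩⟩
      · rintro ⟨y, h₁, h₂⟩; exact ⟨⟨_, h₁⟩, _, h₂⟩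
    · ext x
      simp only [Set.mem_inter_iff, Set.mem_ofPred_eq, Set.mem_union, not_and_or, exists_or]

/-- A dummy quantifier at level 0; above it, induction under the outermost quantifier. -/
theorem IsSigma.succ {Z A : Set ℕ} {n : ℕ} (hA : IsSigma Z n A) : IsSigma Z (n + 1) A := by
  induction n generalizing A with
  | zero =>
    refine isSigma_succ_iff.2 ⟨_, (ReducibleTo.compl hA).preimage
      (Primrec.fst.comp Primrec.unpair), ?_⟩
    ext x; simp
  | succ n ih =>
    obtain ⟨C, hC, rfl⟩ := isSigma_succ_iff.1 hA
    exact isSigma_exists_notMem (ih hC)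

theorem IsSigma.mono_level {Z A : Set ℕ} {m n : ℕ} (h : m ≤ n) (hA : IsSigma Z m A) :
    IsSigma Z n A :=
  Nat.le_induction hA (fun _ _ => IsSigma.succ) n h

theorem IsSigma.mono_oracle {Z X A : Set ℕ} {n : ℕ} (h : ReducibleTo Z X) (hA : IsSigma Z n A) :
    IsSigma X n A := by
  induction n generalizing A with
  | zero => exact TuringReducible.trans hA h
  | succ n ih =>
    obtain ⟨C, hC, rfl⟩ := isSigma_succ_iff.1 hA
    exact isSigma_exists_notMem (ih hC)

theorem mem_join_even {Z G : Set ℕ} {n : ℕ} : 2 * n ∈ join Z G ↔ n ∈ Z := by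
  simp only [join, Set.mem_union, Set.mem_image]
  constructor
  · rintro (⟨m, hm, h⟩ | ⟨m, hm, h⟩)
    · rwa [show n = m by omega]
    · omega
  · exact fun h => Or.inl ⟨n, h, rfl⟩

theorem mem_join_odd {Z G : Set ℕ} {n : ℕ} : 2 * n + 1 ∈ join Z G ↔ n ∈ G := by
  simp only [join, Set.mem_union, Set.mem_image]
  constructor
  · rintro (⟨m, hm, h⟩ | ⟨m, hm, h⟩)
    · omega
    · rwa [show n = m by omega]
  · exact fun h => Or.inr ⟨n, h, rfl⟩

theorem reducibleTo_join_left (Z G : Set ℕ) : ReducibleTo Z (join Z G) := by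
  have h : ReducibleTo (join Z G) (join Z G) := TuringReducible.refl _
  have := h.preimage Primrec.nat_double
  rwa [show (fun n => 2 * n) ⁻¹' join Z G = Z from Set.ext fun n => mem_join_even] at this

/-! ### A universal family of effectively open sets -/

/-- The `k`-th approximation to the universal family of open sets: one of the first `k` initial
segments of `ζ` and `σ` is accepted in `k` steps by the code in the index `i`, which is run with
the parameter in `i`. -/
def Accepts (k : ℕ) (ζ σ : List Bool) (i : ℕ) : Prop :=
  ∃ m < k, (Code.evaln k (Denumerable.ofNat Code i.unpair.1)
    (encode (i.unpair.2, ζ.take m, σ.take m))).isSome = true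

/-- `G` belongs to the open set, effectively open relative to `Z`, with index `i`. -/
def Hit (Z G : Set ℕ) (i : ℕ) : Prop :=
  ∃ k, Accepts k (initSeg Z k) (initSeg G k) i

theorem Accepts.mono {Z G : Set ℕ} {i k k' : ℕ} (hk : k ≤ k')
    (h : Accepts k (initSeg Z k) (initSeg G k) i) :
    Accepts k' (initSeg Z k') (initSeg G k') i := by
  obtain ⟨m, hm, h⟩ := h
  obtain ⟨v, hv⟩ := Option.isSome_iff_exists.1 h
  refine ⟨m, by omega, Option.isSome_iff_exists.2 ⟨v, Code.evaln_mono hk ?_⟩⟩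
  rw [take_initSeg _ (by omega), take_initSeg _ (by omega)] at hv ⊢
  exact hv

theorem hit_iff {Z G : Set ℕ} {i : ℕ} : Hit Z G i ↔ ∃ m, (Code.eval
    (Denumerable.ofNat Code i.unpair.1) (encode (i.unpair.2, initSeg Z m, initSeg G m))).Dom := by
  constructor
  · rintro ⟨k, m, hm, h⟩
    rw [take_initSeg _ hm.le, take_initSeg _ hm.le] at h
    obtain ⟨v, hv⟩ := Option.isSome_iff_exists.1 h
    exact ⟨m, Part.dom_iff_mem.2 ⟨v, Code.evaln_sound hv⟩⟩
  · rintro ⟨m, h⟩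
    obtain ⟨v, hv⟩ := Part.dom_iff_mem.1 h
    obtain ⟨k, hk⟩ := Code.evaln_complete.1 hv
    refine ⟨max k (m + 1), m, by omega, Option.isSome_iff_exists.2
      ⟨v, Code.evaln_mono (le_max_left _ _) ?_⟩⟩
    rwa [take_initSeg _ (by omega), take_initSeg _ (by omega)]

/-- A primitive recursive predicate is r.e., hence the halting domain of some code; `x` enters as a
parameter, so one `c` serves all `Z`, `G` and `x`. -/
theorem exists_index {W : ℕ → List Bool → List Bool → Prop}
    (hW : PrimrecPred fun q : ℕ × List Bool × List Bool => W q.1 q.2.1 q.2.2) :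
    ∃ c : ℕ, ∀ Z G x, Hit Z G (Nat.pair c x) ↔ ∃ m, W x (initSeg Z m) (initSeg G m) := by
  obtain ⟨hd, hp⟩ := hW
  have hre : REPred fun q : ℕ × List Bool × List Bool => W q.1 q.2.1 q.2.2 :=
    ComputablePred.to_re ⟨hd, hp.to_comp⟩
  obtain ⟨c, hc⟩ := Code.exists_code.1 hre
  refine ⟨encode c, fun Z G x => ?_⟩
  rw [hit_iff]
  refine exists_congr fun m => ?_
  rw [Nat.unpair_pair, Denumerable.ofNat_encode, hc]
  simp [Part.assert]

theorem primrecPred_accepts : PrimrecPred fun q : ((ℕ × List Bool) × List Bool) × ℕ =>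
    Accepts q.1.1.1 q.1.1.2 q.1.2 q.2 := by
  refine primrecPred_exists_lt (Primrec.fst.comp (Primrec.fst.comp Primrec.fst)) ?_
  have hk : Primrec fun q : (((ℕ × List Bool) × List Bool) × ℕ) × ℕ => q.1.1.1.1 :=
    Primrec.fst.comp (Primrec.fst.comp (Primrec.fst.comp Primrec.fst))
  have hζ : Primrec fun q : (((ℕ × List Bool) × List Bool) × ℕ) × ℕ => q.1.1.1.2 :=
    Primrec.snd.comp (Primrec.fst.comp (Primrec.fst.comp Primrec.fst))
  have hσ : Primrec fun q : (((ℕ × List Bool) × List Bool) × ℕ) × ℕ => q.1.1.2 :=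
    Primrec.snd.comp (Primrec.fst.comp Primrec.fst)
  have hi : Primrec fun q : (((ℕ × List Bool) × List Bool) × ℕ) × ℕ => q.1.2.unpair :=
    Primrec.unpair.comp (Primrec.snd.comp Primrec.fst)
  exact primrecPred_eq (Primrec.option_isSome.comp (Code.primrec_evaln.comp
    ((hk.pair ((Primrec.ofNat Code).comp (Primrec.fst.comp hi))).pair (Primrec.encode.comp
      ((Primrec.snd.comp hi).pair ((Primrec.list_take.comp Primrec.snd hζ).pair
        (Primrec.list_take.comp Primrec.snd hσ))))))) (Primrec.const true)

/-! ### Compactness and effectively closed classes -/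

/-- The list of all binary strings of a given length. -/
def strings : ℕ → List (List Bool) :=
  Nat.rec [[]] fun _ L => L.map (List.cons true) ++ L.map (List.cons false)

theorem mem_strings {σ : List Bool} {n : ℕ} : σ ∈ strings n ↔ σ.length = n := by
  induction n generalizing σ with
  | zero => simp [strings]
  | succ n ih =>
    have : strings (n + 1) = (strings n).map (List.cons true) ++ (strings n).map (List.cons false) :=
      rfl
    rw [this]
    rcases σ with - | ⟨b, σ⟩
    · simp
    · cases b <;> simp [ih]

theorem primrec_strings : Primrec strings :=
  Primrec.nat_rec₁ _ (Primrec.list_append.comp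
    (Primrec.list_map Primrec.snd (Primrec.list_cons.comp (Primrec.const true) Primrec.snd))
    (Primrec.list_map Primrec.snd (Primrec.list_cons.comp (Primrec.const false) Primrec.snd)))

theorem exists_initSeg_eq (σ : List Bool) : ∃ G, initSeg G σ.length = σ := by
  refine ⟨{i | σ[i]? = some true}, List.ext_getElem? fun i => ?_⟩
  rw [getElem?_initSeg]
  split_ifs with h
  · rw [List.getElem?_eq_getElem h]; simp [List.getElem?_eq_getElem h]
  · rw [List.getElem?_eq_none (not_lt.1 h)]

/-- Compactness of Cantor space: the sets cut out by the `D k` are closed, nonempty and decreasing.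
-/
theorem exists_forall_initSeg {D : ℕ → List Bool → Prop} (hne : ∀ k, ∃ G, D k (initSeg G k))
    (hD : ∀ G k, D (k + 1) (initSeg G (k + 1)) → D k (initSeg G k)) :
    ∃ G, ∀ k, D k (initSeg G k) := by
  let K : ℕ → Set (ℕ → Bool) := fun k => {g | D k (initSeg {i | g i = true} k)}
  have hcl : ∀ k, IsClosed (K k) := fun k => by
    have : K k = (fun (g : ℕ → Bool) (i : Fin k) => g i) ⁻¹'
        {u | D k (List.ofFn u)} := by
      ext g
      have : initSeg {i | g i = true} k = List.ofFn fun i : Fin k => g i := by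
        refine List.ext_getElem (by simp [initSeg]) fun i h₁ h₂ => by simp [initSeg]
      simp only [K, Set.mem_preimage, Set.mem_ofPred_eq, this]
    rw [this]
    exact (isClosed_discrete _).preimage (by fun_prop)
  obtain ⟨g, hg⟩ := IsCompact.nonempty_iInter_of_sequence_nonempty_isCompact_isClosed K
    (fun k g hg => hD _ _ hg) (fun k => by
      obtain ⟨G, hG⟩ := hne k
      classical
      refine ⟨fun i => decide (i ∈ G), ?_⟩
      simpa [K] using hG) (hcl 0).isCompact hcl
  exact ⟨{i | g i = true}, fun k => Set.mem_iInter.1 hg k⟩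

/-- The effectively closed set given by a list of indices of open sets to be avoided. -/
def closedSet (Z : Set ℕ) (l : List ℕ) : Set (Set ℕ) :=
  {G | ∀ i ∈ l, ¬ Hit Z G i}

theorem closedSet_anti {Z : Set ℕ} {l l' : List ℕ} (h : l ⊆ l') :
    closedSet Z l' ⊆ closedSet Z l :=
  fun _ hG i hi => hG i (h hi)

/-- By compactness an open cover of Cantor space is already seen at a finite stage, which makes
emptiness `Σ_1`. -/
theorem closedSet_eq_empty_iff {Z : Set ℕ} {l : List ℕ} : closedSet Z l = ∅ ↔
    ∃ k, ∀ σ ∈ strings k, ∃ i ∈ l, Accepts k (initSeg Z k) σ i := by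
  constructor
  · intro h
    by_contra! hc
    obtain ⟨G, hG⟩ := exists_forall_initSeg (D := fun k σ => ∀ i ∈ l, ¬ Accepts k (initSeg Z k) σ i)
      (fun k => by
        obtain ⟨σ, hσ, h⟩ := hc k
        obtain ⟨G, hG⟩ := exists_initSeg_eq σ
        rw [mem_strings.1 hσ] at hG
        exact ⟨G, by rwa [hG]⟩)
      (fun G k h i hi ha => h i hi (ha.mono k.le_succ))
    have : G ∈ closedSet Z l := fun i hi ⟨k, hk⟩ => hG k i hi hk
    simp [h] at this
  · rintro ⟨k, hk⟩
    refine Set.eq_empty_iff_forall_notMem.2 fun G hG => ?_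
    obtain ⟨i, hi, ha⟩ := hk (initSeg G k) (mem_strings.2 (length_initSeg G k))
    exact hG i hi ⟨k, ha⟩

theorem isSigma_closedSet_eq_empty (Z : Set ℕ) :
    IsSigma Z 1 {w | closedSet Z (Denumerable.ofNat (List ℕ) w) = ∅} := by
  have h : ReducibleTo {w | ∀ σ ∈ strings w.unpair.2, ∃ i ∈ Denumerable.ofNat (List ℕ) w.unpair.1,
      Accepts w.unpair.2 (initSeg Z w.unpair.2) σ i} Z := by
    refine reducibleTo_of_primrecPred Z (b := fun w => w.unpair.2) (P := fun w ζ =>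
      ∀ σ ∈ strings w.unpair.2, ∃ i ∈ Denumerable.ofNat (List ℕ) w.unpair.1,
        Accepts w.unpair.2 ζ σ i) ?_ (Primrec.snd.comp Primrec.unpair)
    have hu : Primrec fun q : ℕ × List Bool => q.1.unpair := Primrec.unpair.comp Primrec.fst
    refine primrecPred_forall_mem (primrec_strings.comp (Primrec.snd.comp hu))
      (primrecPred_exists_mem ((Primrec.ofNat (List ℕ)).comp
        (Primrec.fst.comp (hu.comp Primrec.fst))) ?_)
    have h₁ := Primrec.fst (α := (ℕ × List Bool) × List Bool) (β := ℕ)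
    exact primrecPred_accepts.comp (((((Primrec.snd.comp (hu.comp (Primrec.fst.comp h₁))).pair
      (Primrec.snd.comp (Primrec.fst.comp h₁))).pair (Primrec.snd.comp h₁)).pair Primrec.snd))
  refine isSigma_succ_iff.2 ⟨_, h.compl, ?_⟩
  ext w
  simp [closedSet_eq_empty_iff]

/-! ### Universal formulas relative to the join -/

/-- The string whose even bits are those of `ζ` and whose odd bits are those of `σ`. -/
def joinList (ζ σ : List Bool) : List Bool :=
  (List.range (2 * ζ.length)).map fun i =>
    if i % 2 = 0 then ζ.getD (i / 2) false else σ.getD (i / 2) false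

theorem joinList_initSeg (Z G : Set ℕ) (m : ℕ) :
    joinList (initSeg Z m) (initSeg G m) = initSeg (join Z G) (2 * m) := by
  rw [joinList, length_initSeg, initSeg.eq_1 (join Z G)]
  refine List.map_congr_left fun i hi => ?_
  have hi := List.mem_range.1 hi
  simp only [List.getD_eq_getElem?_getD, getElem?_initSeg, show i / 2 < m by omega, if_true,
    Option.getD_some]
  rcases Nat.even_or_odd' i with ⟨j, rfl | rfl⟩
  · simp [mem_join_even]
  · simp [mem_join_odd, show (2 * j + 1) / 2 = j by omega]

theorem primrec_joinList : Primrec₂ joinList := by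
  have h₁ := Primrec.fst (α := List Bool × List Bool) (β := ℕ)
  have h₂ := Primrec.snd (α := List Bool × List Bool) (β := ℕ)
  have hget : Primrec₂ fun (l : List Bool) n => l.getD n false := Primrec.list_getD false
  have hdiv := Primrec.nat_div.comp h₂ (Primrec.const 2)
  exact Primrec.list_map (Primrec.list_range.comp (Primrec.nat_double.comp
      (Primrec.list_length.comp Primrec.fst)))
    (Primrec.ite (primrecPred_eq (Primrec.nat_mod.comp h₂ (Primrec.const 2)) (Primrec.const 0))
      (hget.comp (Primrec.fst.comp h₁) hdiv) (hget.comp (Primrec.snd.comp h₁) hdiv))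

/-- The universal `Σ_{n+1}` formula with code `c`, relative to `Z` and `G`. -/
def Sat (Z G : Set ℕ) (c : ℕ) : ℕ → ℕ → Prop
  | 0, x => Hit Z G (Nat.pair c x)
  | n + 1, x => ∃ y, ¬ Sat Z G c n (Nat.pair x y)

theorem zero_mem_charFn {C : Set ℕ} {x : ℕ} : 0 ∈ charFn C x ↔ x ∉ C := by
  by_cases h : x ∈ C <;> simp [charFn, h]

theorem exists_sat {Z G A : Set ℕ} {n : ℕ} (hA : IsSigma (join Z G) (n + 1) A) :
    ∃ c, A = {x | Sat Z G c n x} := by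
  induction n generalizing A with
  | zero =>
    obtain ⟨C, hC, rfl⟩ := isSigma_succ_iff.1 hA
    obtain ⟨R, hR, mR, eR⟩ := graphEnum_of_recursiveIn (RecursiveIn.iff_nat.1 hC)
    obtain ⟨c, hc⟩ := exists_index
      (W := fun x ζ σ => ∃ y < ζ.length, R (Nat.pair x y) 0 (joinList ζ σ)) (by
        refine primrecPred_exists_lt
          (Primrec.list_length.comp (Primrec.fst.comp Primrec.snd)) ?_
        have h₁ := Primrec.fst (α := ℕ × List Bool × List Bool) (β := ℕ)
        exact hR.comp (((Primrec₂.natPair.comp (Primrec.fst.comp h₁) Primrec.snd).pair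
          (Primrec.const 0)).pair (primrec_joinList.comp
            (Primrec.fst.comp (Primrec.snd.comp h₁)) (Primrec.snd.comp (Primrec.snd.comp h₁)))))
    refine ⟨c, Set.ext fun x => ?_⟩
    simp only [Set.mem_ofPred_eq, Sat, hc, joinList_initSeg, length_initSeg]
    constructor
    · rintro ⟨y, hy⟩
      obtain ⟨k, hk⟩ := (eR _ _).1 (zero_mem_charFn.2 hy)
      exact ⟨max k (y + 1), y, by omega, mR _ _ _ _ (initSeg_prefix _ (by omega)) hk⟩
    · rintro ⟨m, y, -, h⟩
      exact ⟨y, zero_mem_charFn.1 ((eR _ _).2 ⟨_, h⟩)⟩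
  | succ n ih =>
    obtain ⟨C, hC, rfl⟩ := isSigma_succ_iff.1 hA
    obtain ⟨c, rfl⟩ := ih hC
    exact ⟨c, rfl⟩

theorem countable_isSigma (Z : Set ℕ) : {A : Set ℕ | ∃ n, IsSigma Z n A}.Countable := by
  refine (Set.countable_range fun p : ℕ × ℕ => {x | Sat Z ∅ p.1 p.2 x}).mono ?_
  rintro A ⟨n, hA⟩
  -- `Sat` at `n` captures level `n + 1`, so `hA` is raised one level.
  obtain ⟨c, rfl⟩ := exists_sat (G := ∅) (hA.succ.mono_oracle (reducibleTo_join_left Z ∅))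
  exact ⟨(c, n), rfl⟩

/-! ### The forcing question and its complexity -/

/-- The forcing question for the universal `Σ_{n+1}` formula with code `c`, asked of the condition
given by a list of indices. -/
def Question (Z : Set ℕ) (c : ℕ) : ℕ → List ℕ → ℕ → Prop
  | 0, l, x => closedSet Z (Nat.pair c x :: l) = ∅
  | n + 1, l, x => ∃ y, ∃ l' : List ℕ, closedSet Z (l' ++ l) ≠ ∅ ∧
      ¬ Question Z c n (l' ++ l) (Nat.pair x y)

theorem closedSet_congr {Z : Set ℕ} {l l' : List ℕ} (h : ∀ i, i ∈ l ↔ i ∈ l') :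
    closedSet Z l = closedSet Z l' := by
  simp [closedSet, h]

theorem question_congr {Z : Set ℕ} {c n x : ℕ} {l l' : List ℕ} (h : ∀ i, i ∈ l ↔ i ∈ l') :
    Question Z c n l x ↔ Question Z c n l' x := by
  induction n generalizing l l' x with
  | zero =>
    rw [Question, Question, closedSet_congr (l' := Nat.pair c x :: l') (by simp [h])]
  | succ n ih =>
    have h' : ∀ k i, i ∈ k ++ l ↔ i ∈ k ++ l' := by simp [h]
    simp only [Question, fun k y => ih (x := y) (h' k), fun k => closedSet_congr (Z := Z) (h' k)]

theorem isSigma_question (Z : Set ℕ) (c n : ℕ) :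
    IsSigma Z (n + 1) {w | Question Z c n (Denumerable.ofNat (List ℕ) w.unpair.1) w.unpair.2} := by
  have hl : Primrec fun w : ℕ => Denumerable.ofNat (List ℕ) w.unpair.1 :=
    (Primrec.ofNat (List ℕ)).comp (Primrec.fst.comp Primrec.unpair)
  induction n with
  | zero =>
    have h := (isSigma_closedSet_eq_empty Z).preimage (Primrec.encode.comp
      (Primrec.list_cons.comp (Primrec₂.natPair.comp (Primrec.const c)
        (Primrec.snd.comp Primrec.unpair)) hl))
    simpa [Question] using h
  | succ n ih =>
    have hv : Primrec fun u : ℕ => u.unpair.2 := Primrec.snd.comp Primrec.unpair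
    have hw : Primrec fun u : ℕ => u.unpair.1 := Primrec.fst.comp Primrec.unpair
    have happ : Primrec fun u : ℕ => encode (Denumerable.ofNat (List ℕ) u.unpair.2.unpair.1 ++
        Denumerable.ofNat (List ℕ) u.unpair.1.unpair.1) :=
      Primrec.encode.comp (Primrec.list_append.comp (hl.comp hv) (hl.comp hw))
    -- Emptiness is only `Σ_1`, so testing that an extension is nonempty costs no more than the
    -- negated question.
    have h₁ := ((isSigma_closedSet_eq_empty Z).preimage happ).mono_level
      (show 1 ≤ n + 1 by omega)
    have h₂ := ih.preimage (Primrec₂.natPair.comp happ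
      (Primrec₂.natPair.comp (hv.comp hw) (hv.comp hv)))
    refine isSigma_succ_iff.2 ⟨_, (h₁.inter_union h₂).2, ?_⟩
    ext w
    simp only [Set.mem_ofPred_eq, Question, Set.mem_union, Set.mem_preimage, Nat.unpair_pair,
      Denumerable.ofNat_encode, not_or]
    constructor
    · rintro ⟨y, l', h⟩
      exact ⟨Nat.pair (encode l') y, by simpa using h⟩
    · rintro ⟨v, h⟩
      exact ⟨_, _, h⟩

/-! ### The forcing relation and its truth -/

/-- The condition `l` forces the universal `Σ_{n+1}` formula with code `c` to fail at `x`. -/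
def ForcesNot (Z : Set ℕ) (c : ℕ) : ℕ → List ℕ → ℕ → Prop
  | 0, l, x => Nat.pair c x ∈ l
  | n + 1, l, x => ¬ Question Z c (n + 1) l x

/-- The condition `l` forces the universal `Σ_{n+1}` formula with code `c` to hold at `x`. -/
def Forces (Z : Set ℕ) (c : ℕ) : ℕ → List ℕ → ℕ → Prop
  | 0, l, x => Question Z c 0 l x
  | n + 1, l, x => ∃ y, ForcesNot Z c n l (Nat.pair x y)

/-- At level 0 a negative answer says exactly that adding the index leaves a nonempty class; above,
the negative answer is itself the forcing. -/
theorem exists_forcesNot {Z : Set ℕ} {c n x : ℕ} {l : List ℕ} (hl : closedSet Z l ≠ ∅)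
    (h : ¬ Question Z c n l x) : ∃ l', l ⊆ l' ∧ closedSet Z l' ≠ ∅ ∧ ForcesNot Z c n l' x := by
  cases n with
  | zero => exact ⟨_, List.subset_cons_self _ _, h, List.mem_cons_self⟩
  | succ n => exact ⟨l, List.Subset.refl l, hl, h⟩

theorem exists_forces {Z : Set ℕ} {c n x : ℕ} {l : List ℕ} (hl : closedSet Z l ≠ ∅)
    (h : Question Z c n l x) : ∃ l', l ⊆ l' ∧ closedSet Z l' ≠ ∅ ∧ Forces Z c n l' x := by
  cases n with
  | zero => exact ⟨l, List.Subset.refl l, hl, h⟩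
  | succ n =>
    obtain ⟨y, l', hl', hq⟩ := h
    obtain ⟨l'', hs, hne, hf⟩ := exists_forcesNot hl' hq
    exact ⟨l'', List.Subset.trans (List.subset_append_right _ _) hs, hne, y, hf⟩

/-- `G` meets a condition which decides each universal formula. -/
def Decides (Z G : Set ℕ) : Prop :=
  ∀ c n x, ∃ l, G ∈ closedSet Z l ∧ (Forces Z c n l x ∨ ForcesNot Z c n l x)

/-- If a witness `y` existed, a condition met by `G` would decide its instance. Deciding it
positively refers to a negation two levels down, hence strong induction; deciding it negatively
clashes with `l`, as both conditions contain `G` and so are compatible. -/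
theorem not_sat_of_forcesNot {Z G : Set ℕ} (hG : Decides Z G) {c n x : ℕ} {l : List ℕ}
    (hl : G ∈ closedSet Z l) (h : ForcesNot Z c n l x) : ¬ Sat Z G c n x := by
  induction n using Nat.strong_induction_on generalizing l x with
  | _ n ih =>
  cases n with
  | zero => exact hl _ h
  | succ n =>
    rintro ⟨y, hy⟩
    obtain ⟨l', hl', hF | hF⟩ := hG c n (Nat.pair x y)
    · cases n with
      | zero =>
        refine hy (by_contra fun hn => ?_)
        have : G ∈ closedSet Z (Nat.pair c (Nat.pair x y) :: l') :=
          List.forall_mem_cons.2 ⟨hn, hl'⟩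
        rw [Forces, Question] at hF
        simp [hF] at this
      | succ n =>
        obtain ⟨z, hz⟩ := hF
        exact hy ⟨z, ih n (by omega) hl' hz⟩
    · have hne : G ∈ closedSet Z (l' ++ l) := List.forall_mem_append.2 ⟨hl', hl⟩
      have hq : Question Z c n (l' ++ l) (Nat.pair x y) :=
        by_contra fun hn => h ⟨y, l', Set.nonempty_iff_ne_empty.1 ⟨G, hne⟩, hn⟩
      cases n with
      | zero =>
        have hc : G ∈ closedSet Z (Nat.pair c (Nat.pair x y) :: (l' ++ l)) :=
          closedSet_anti (List.cons_subset.2 ⟨List.mem_append_left _ hF, List.Subset.refl _⟩) hne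
        rw [Question] at hq
        simp [hq] at hc
      | succ n =>
        obtain ⟨z, k, hk, hnq⟩ := hq
        -- The extension witnessing the positive answer also extends `l'`, where the answer was
        -- negative.
        have hcomm : ∀ i, i ∈ k ++ (l' ++ l) ↔ i ∈ (k ++ l) ++ l' := by
          intro i; simp only [List.mem_append]; tauto
        rw [closedSet_congr hcomm] at hk
        rw [question_congr hcomm] at hnq
        exact hF ⟨z, k ++ l, hk, hnq⟩

theorem sat_of_forces {Z G : Set ℕ} (hG : Decides Z G) {c n x : ℕ} {l : List ℕ}
    (hl : G ∈ closedSet Z l) (h : Forces Z c n l x) : Sat Z G c n x := by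
  cases n with
  | zero =>
    by_contra hn
    have : G ∈ closedSet Z (Nat.pair c x :: l) := List.forall_mem_cons.2 ⟨hn, hl⟩
    rw [Forces, Question] at h
    simp [h] at this
  | succ n =>
    obtain ⟨y, hy⟩ := h
    exact ⟨y, not_sat_of_forcesNot hG hl hy⟩

/-! ### Generic sets and preservation -/

theorem exists_generic {Z : Set ℕ} {ι : Type*} [Countable ι] (D : ι → List ℕ → Prop)
    (hD : ∀ i l, closedSet Z l ≠ ∅ → ∃ l', l ⊆ l' ∧ closedSet Z l' ≠ ∅ ∧ D i l') {l₀ : List ℕ}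
    (h₀ : closedSet Z l₀ ≠ ∅) :
    ∃ G ∈ closedSet Z l₀, ∀ i, ∃ l, G ∈ closedSet Z l ∧ D i l := by
  rcases isEmpty_or_nonempty ι with hι | hι
  · obtain ⟨G, hG⟩ := Set.nonempty_iff_ne_empty.2 h₀
    exact ⟨G, hG, fun i => hι.elim i⟩
  obtain ⟨e, he⟩ := exists_surjective_nat ι
  choose! f hf₁ hf₂ hf₃ using hD
  let s : ℕ → List ℕ := Nat.rec l₀ fun n l => f (e n) l
  have hs : ∀ n, closedSet Z (s n) ≠ ∅ := fun n => by
    induction n with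
    | zero => exact h₀
    | succ n ih => exact hf₂ _ _ ih
  have hmono : ∀ n, s n ⊆ s (n + 1) := fun n => hf₁ _ _ (hs n)
  -- Diagonal approximation: at level `k` only the condition `s k` is tested, for `k` steps.
  -- Compactness then yields a common member of all the conditions.
  obtain ⟨G, hG⟩ := exists_forall_initSeg
    (D := fun k σ => ∀ i ∈ s k, ¬ Accepts k (initSeg Z k) σ i) (fun k => by
      obtain ⟨G, hG⟩ := Set.nonempty_iff_ne_empty.2 (hs k)
      exact ⟨G, fun i hi h => hG i hi ⟨k, h⟩⟩)
    (fun G k h i hi ha => h i (hmono k hi) (ha.mono k.le_succ))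
  have hGs : ∀ n, G ∈ closedSet Z (s n) := fun n i hi ⟨k, hk⟩ => by
    have hm : ∀ m, n ≤ m → s n ⊆ s m := fun m h =>
      Nat.le_induction (List.Subset.refl _) (fun m _ ih => List.Subset.trans ih (hmono m)) m h
    exact hG (max n k) i (hm _ (le_max_left n k) hi) (hk.mono (le_max_right n k))
  refine ⟨G, hGs 0, fun i => ?_⟩
  obtain ⟨n, rfl⟩ := he i
  exact ⟨s (n + 1), hGs (n + 1), hf₃ _ _ (hs n)⟩

/-- The question's truth set is `Σ_{n+1}` relative to `Z`, so it cannot be `A`; a point of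
disagreement is then made permanent. -/
theorem exists_forces_ne {Z A : Set ℕ} {n : ℕ} (hA : ¬ IsSigma Z (n + 1) A) (c : ℕ) {l : List ℕ}
    (hl : closedSet Z l ≠ ∅) : ∃ l', l ⊆ l' ∧ closedSet Z l' ≠ ∅ ∧
      ∃ x, x ∈ A ∧ ForcesNot Z c n l' x ∨ x ∉ A ∧ Forces Z c n l' x := by
  have hS : IsSigma Z (n + 1) {x | Question Z c n l x} := by
    simpa using (isSigma_question Z c n).preimage
      (Primrec₂.natPair.comp (Primrec.const (encode l)) Primrec.id)
  obtain ⟨x, hx⟩ : ∃ x, ¬ (x ∈ A ↔ Question Z c n l x) := by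
    by_contra! h
    exact hA ((show A = {x | Question Z c n l x} from Set.ext h) ▸ hS)
  by_cases hxA : x ∈ A
  · obtain ⟨l', h₁, h₂, h₃⟩ := exists_forcesNot hl (show ¬ Question Z c n l x by tauto)
    exact ⟨l', h₁, h₂, x, .inl ⟨hxA, h₃⟩⟩
  · obtain ⟨l', h₁, h₂, h₃⟩ := exists_forces hl (show Question Z c n l x by tauto)
    exact ⟨l', h₁, h₂, x, .inr ⟨hxA, h₃⟩⟩

theorem exists_mem_closedSet_not_isSigma {Z : Set ℕ} {𝒜 : Set (Set ℕ)} (h𝒜 : 𝒜.Countable)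
    {l₀ : List ℕ} (h₀ : closedSet Z l₀ ≠ ∅) :
    ∃ G ∈ closedSet Z l₀, ∀ A ∈ 𝒜, ∀ n, ¬ IsSigma Z (n + 1) A → ¬ IsSigma (join Z G) (n + 1) A := by
  have := h𝒜.to_subtype
  let ι₁ := {p : 𝒜 × ℕ // ¬ IsSigma Z (p.2 + 1) p.1}
  obtain ⟨G, hG₀, hG⟩ := exists_generic (Z := Z) (ι := (ℕ × ℕ × ℕ) ⊕ ι₁ × ℕ)
    (Sum.elim (fun p l => Forces Z p.1 p.2.1 l p.2.2 ∨ ForcesNot Z p.1 p.2.1 l p.2.2)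
      fun p l => ∃ x, x ∈ p.1.1.1.1 ∧ ForcesNot Z p.2 p.1.1.2 l x ∨
        x ∉ p.1.1.1.1 ∧ Forces Z p.2 p.1.1.2 l x) (by
      rintro (⟨c, n, x⟩ | ⟨⟨⟨A, n⟩, hA⟩, c⟩) l hl
      · by_cases h : Question Z c n l x
        · obtain ⟨l', h₁, h₂, h₃⟩ := exists_forces hl h
          exact ⟨l', h₁, h₂, .inl h₃⟩
        · obtain ⟨l', h₁, h₂, h₃⟩ := exists_forcesNot hl h
          exact ⟨l', h₁, h₂, .inr h₃⟩
      · exact exists_forces_ne hA c hl) h₀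
  have hdec : Decides Z G := fun c n x => hG (.inl (c, n, x))
  refine ⟨G, hG₀, fun A hA n hn hs => ?_⟩
  obtain ⟨c, rfl⟩ := exists_sat hs
  obtain ⟨l, hl, x, ⟨hx, hF⟩ | ⟨hx, hF⟩⟩ := hG (.inr (⟨(⟨_, hA⟩, n), hn⟩, c))
  · exact not_sat_of_forcesNot hdec hl hF hx
  · exact hx (sat_of_forces hdec hl hF)

theorem exists_mem_closedSet_preserves {Z : Set ℕ} {l₀ : List ℕ} (h₀ : closedSet Z l₀ ≠ ∅) :
    ∃ G ∈ closedSet Z l₀, PreservesArithHierarchy G Z := by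
  -- Complements are included because failing to be `Π` is a failure of the complement to be `Σ`.
  have hc : ({A : Set ℕ | ∃ n, IsSigma Z n A} ∪ compl '' {A | ∃ n, IsSigma Z n A}).Countable :=
    (countable_isSigma Z).union ((countable_isSigma Z).image _)
  obtain ⟨G, hG₀, hG⟩ := exists_mem_closedSet_not_isSigma hc h₀
  refine ⟨G, hG₀, fun n hn A => ?_⟩
  obtain ⟨n, rfl⟩ := Nat.exists_eq_succ_of_ne_zero hn.ne'
  have up : ∀ {m B}, IsSigma Z m B → IsSigma (join Z G) m B := fun h =>
    h.mono_oracle (reducibleTo_join_left Z G)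
  refine ⟨fun ⟨h₁, h₂⟩ => ⟨up h₁, fun h => h₂ ⟨h₁, ?_⟩⟩,
    fun ⟨h₁, h₂⟩ => ⟨up h₁, fun h => h₂ ⟨?_, h₁⟩⟩,
    fun ⟨⟨h₁, h₂⟩, h₃, h₄⟩ => ⟨⟨up h₁, up h₂⟩, hG _ (.inl ⟨_, h₁⟩) n h₃, hG _ (.inl ⟨_, h₂⟩) n h₄⟩⟩
  · exact by_contra fun hn => hG _ (.inr ⟨A, ⟨_, h₁⟩, rfl⟩) n hn h.2
  · exact by_contra fun hn => hG _ (.inr ⟨Aᶜ, ⟨_, h₁⟩, compl_compl A⟩) n hn h.1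

/-! ### Trees as conditions -/

/-- The open set to be avoided consists of the `G` with an initial segment that `Z` computes to be
outside the coded set. -/
theorem exists_closedSet_eq_paths {X Z : Set ℕ} (h : ReducibleTo X Z) :
    ∃ i, ∀ G, G ∈ closedSet Z [i] ↔ IsPath (codedStrings X) G := by
  obtain ⟨R, hR, mR, eR⟩ := graphEnum_of_recursiveIn (RecursiveIn.iff_nat.1 h)
  obtain ⟨c, hc⟩ := exists_index
    (W := fun _ ζ σ => ∃ n < σ.length, R (encode (σ.take n)) 0 ζ) (by
      refine primrecPred_exists_lt (Primrec.list_length.comp (Primrec.snd.comp Primrec.snd)) ?_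
      have h₁ := Primrec.fst (α := ℕ × List Bool × List Bool) (β := ℕ)
      exact hR.comp (((Primrec.encode.comp (Primrec.list_take.comp Primrec.snd
        (Primrec.snd.comp (Primrec.snd.comp h₁)))).pair (Primrec.const 0)).pair
          (Primrec.fst.comp (Primrec.snd.comp h₁))))
  refine ⟨Nat.pair c 0, fun G => ?_⟩
  simp only [closedSet, Set.mem_ofPred_eq, List.forall_mem_singleton, hc, length_initSeg, IsPath,
    codedStrings]
  constructor
  · intro hG n
    by_contra hn
    obtain ⟨k, hk⟩ := (eR _ _).1 (zero_mem_charFn.2 hn)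
    refine hG ⟨max k (n + 1), n, by omega, ?_⟩
    rw [take_initSeg _ (by omega)]
    exact mR _ _ _ _ (initSeg_prefix _ (by omega)) hk
  · rintro hG ⟨m, n, hn, hr⟩
    rw [take_initSeg _ hn.le] at hr
    exact zero_mem_charFn.1 ((eR _ _).2 ⟨m, hr⟩) (hG n)

theorem exists_isPath {T : Set (List Bool)} (hT : IsBinaryTree T) (hinf : T.Infinite) :
    ∃ G, IsPath T G := by
  refine exists_forall_initSeg (D := fun _ σ => σ ∈ T) (fun k => ?_)
    (fun G k => hT _ _ (initSeg_prefix G k.le_succ))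
  obtain ⟨τ, hτ, hk⟩ : ∃ τ ∈ T, k < τ.length := by
    by_contra! h
    exact hinf ((List.finite_length_le Bool k).subset h)
  obtain ⟨G, hG⟩ := exists_initSeg_eq τ
  exact ⟨G, hT _ _ (initSeg_prefix G hk.le) (by rwa [hG])⟩

end DefStrength

theorem mainTheorem1 : DefStrength.AdmitsPreservation DefStrength.WKL := by
  intro Z X hX
  obtain ⟨i, hi⟩ := DefStrength.exists_closedSet_eq_paths hX
  by_cases h : DefStrength.IsBinaryTree (DefStrength.codedStrings X) ∧
      (DefStrength.codedStrings X).Infinite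
  · obtain ⟨P, hP⟩ := DefStrength.exists_isPath h.1 h.2
    obtain ⟨G, hG, hpres⟩ := DefStrength.exists_mem_closedSet_preserves
      (Set.nonempty_iff_ne_empty.1 ⟨P, (hi P).2 hP⟩)
    exact ⟨G, hpres, fun _ _ => (hi G).1 hG⟩
  -- Without an infinite tree there is no path to find, but preservation is still required, so
  -- forcing starts from the whole space.
  · obtain ⟨G, -, hpres⟩ := DefStrength.exists_mem_closedSet_preserves (Z := Z) (l₀ := [])
      (Set.nonempty_iff_ne_empty.1 ⟨∅, by simp [DefStrength.closedSet]⟩)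
    exact ⟨G, hpres, fun h₁ h₂ => absurd ⟨h₁, h₂⟩ h⟩
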